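/- For $n\in\mathbb N$, a secret is a pair $(z,\pi)$ of a bit string $z\in\{0,1\}^n$ and a permutation $\pi$ of $[n]=\{1,\dots,n\}$. A query is a string $x\in\{0,1\}^n$; it is answered by the score $$f_{z,\pi}(x)=\max\{\,i\in\{0,1,\dots,n\} : z_{\pi(j)}=x_{\pi(j)} \text{ for all } 1\le j\le i\,\}.$$ A deterministic strategy is a rooted tree in which every node carries a query and has $n+1$ children, one for each possible score; on a secret, the strategy starts at the root, asks the query of the current node, and moves to the child selected by the score. Its complexity on $(z,\pi)$ is the number of queries required to identify the secret, i.e. the least $t$ such that $(z,\pi)$ is the only secret consistent with the first $t$ queries and their scores ($\infty$ if there is no such $t$). A randomized strategy is a probability distribution over deterministic strategies; its complexity on $(z,\pi)$ is the expected number of queries required to identify the secret, and its complexity is the maximum of this over all secrets. The randomized query complexity $R(n)$ is the infimum of the complexities of all randomized strategies for $n$ positions. Theorem. $R(n)=\Omega(n\log\log n)$; that is, there are a constant $c>0$ and an $n_0$ such that $R(n)\ge c\,n\log\log n$ for all $n\ge n_0$. -/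

import Mathlib

open Filter MeasureTheory
open scoped ENNReal

namespace PermMastermind

/-- A secret `(z, π)`: a hidden bit string together with a hidden permutation of the positions
(positions are numbered `0, …, n - 1`). -/
abbrev Secret (n : ℕ) : Type := (Fin n → Bool) × Equiv.Perm (Fin n)

/-- The score `f_{z,π}(x)`: the largest `i ∈ {0, …, n}` such that `z` and `x` agree at the first `i`
positions in the order given by `π`. -/
def score {n : ℕ} (s : Secret n) (x : Fin n → Bool) : Fin (n + 1) :=
  ⟨Nat.findGreatest (fun i => ∀ j : Fin n, (j : ℕ) < i → s.1 (s.2 j) = x (s.2 j)) n,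
    Nat.lt_succ_of_le (Nat.findGreatest_le n)⟩

/-- A deterministic strategy: a tree of outdegree `n + 1` with a query at every node. A node is
addressed by the list of scores on the path leading to it from the root `[]`. -/
abbrev DetStrategy (n : ℕ) : Type := List (Fin (n + 1)) → (Fin n → Bool)

namespace DetStrategy

variable {n : ℕ}

/-- The node that strategy `T` reaches on the secret `s` after `t` queries. -/
def node (T : DetStrategy n) (s : Secret n) : ℕ → List (Fin (n + 1))
  | 0 => []
  | t + 1 => node T s t ++ [score s (T (node T s t))]

/-- The query (number `t`, counted from `0`) that `T` asks on the secret `s`. -/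
def query (T : DetStrategy n) (s : Secret n) (t : ℕ) : Fin n → Bool :=
  T (node T s t)

/-- After `t` queries the secret `s` is identified: it is the only secret that is consistent with
the first `t` queries and their scores. -/
def Identified (T : DetStrategy n) (s : Secret n) (t : ℕ) : Prop :=
  ∀ s' : Secret n, (∀ i < t, score s' (query T s i) = score s (query T s i)) → s' = s

/-- The complexity of `T` on the secret `s`: the number of queries required to identify `s`
(`∞` if `s` is never identified). -/
noncomputable def cost (T : DetStrategy n) (s : Secret n) : ℝ≥0∞ :=
  ⨅ (t : ℕ) (_ : Identified T s t), (t : ℝ≥0∞)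

end DetStrategy

/-- A randomized strategy: a probability distribution over deterministic strategies (on the product
σ-algebra, i.e. the one generated by the queries at the individual nodes). -/
abbrev RandStrategy (n : ℕ) : Type := ProbabilityMeasure (DetStrategy n)

/-- The complexity of a randomized strategy: its expected number of queries required to identify
the secret, for the worst secret. -/
noncomputable def RandStrategy.complexity {n : ℕ} (R : RandStrategy n) : ℝ≥0∞ :=
  ⨆ s : Secret n, ∫⁻ T, DetStrategy.cost T s ∂(R : Measure (DetStrategy n))

/-- The randomized query complexity of the problem with `n` positions: the best complexity of a
randomized strategy. -/
noncomputable def randomizedQueryComplexity (n : ℕ) : ℝ≥0∞ :=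
  ⨅ R : RandStrategy n, R.complexity

end PermMastermind

namespace PermMastermind

variable {n : ℕ}

/-! ### Counting permutations with laminar candidate sets -/

/-- The candidate sets `V j` are laminar, an earlier set never properly containing a later one. -/
def Laminar {m : ℕ} (V : Fin m → Finset (Fin n)) : Prop :=
  ∀ i j, i < j → V i ⊆ V j ∨ Disjoint (V i) (V j)

/-- The number of values left for index `j` once the values at all smaller indices are fixed. -/
def choices {m : ℕ} (V : Fin m → Finset (Fin n)) (j : Fin m) : ℕ :=
  (V j).card - (Finset.univ.filter fun i => i < j ∧ V i ⊆ V j).card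

/-- The permutations respecting the candidate sets. -/
def perms (V : Fin n → Finset (Fin n)) : Finset (Equiv.Perm (Fin n)) :=
  Finset.univ.filter fun π => ∀ j, π j ∈ V j

lemma mem_perms {V : Fin n → Finset (Fin n)} {π : Equiv.Perm (Fin n)} :
    π ∈ perms V ↔ ∀ j, π j ∈ V j := by
  simp [perms]

/-- The injections respecting the candidate sets. -/
def injs {m : ℕ} (V : Fin m → Finset (Fin n)) : Finset (Fin m → Fin n) :=
  Finset.univ.filter fun f => Function.Injective f ∧ ∀ j, f j ∈ V j

lemma mem_injs {m : ℕ} {V : Fin m → Finset (Fin n)} {f : Fin m → Fin n} :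
    f ∈ injs V ↔ Function.Injective f ∧ ∀ j, f j ∈ V j := by
  simp [injs]

lemma choices_castSucc {m : ℕ} (V : Fin (m + 1) → Finset (Fin n)) (j : Fin m) :
    choices (fun i => V (Fin.castSucc i)) j = choices V (Fin.castSucc j) := by
  unfold choices
  congr 1
  rw [← Finset.card_map Fin.castSuccEmb]
  congr 1
  ext i
  simp only [Finset.mem_map, Finset.mem_filter, Finset.mem_univ, true_and, Fin.coe_castSuccEmb]
  constructor
  · rintro ⟨a, ⟨h1, h2⟩, rfl⟩
    exact ⟨by simpa using h1, h2⟩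
  · rintro ⟨h1, h2⟩
    have hi : (i : ℕ) < m := lt_of_lt_of_le (Fin.lt_def.1 h1) (by simp [j.isLt.le])
    exact ⟨⟨i, hi⟩, ⟨by simpa [Fin.lt_def] using h1, h2⟩, rfl⟩

lemma card_sdiff_image_eq_choices_last {m : ℕ} {V : Fin (m + 1) → Finset (Fin n)}
    (hV : Laminar V) {f : Fin m → Fin n} (hf : f ∈ injs fun i => V (Fin.castSucc i)) :
    (V (Fin.last m) \ Finset.univ.image f).card = choices V (Fin.last m) := by
  obtain ⟨hinj, hmem⟩ := mem_injs.1 hf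
  unfold choices
  rw [Finset.card_sdiff]
  congr 1
  have : (Finset.univ.filter fun i => i < Fin.last m ∧ V i ⊆ V (Fin.last m))
      = (Finset.univ.filter fun i : Fin m => V i.castSucc ⊆ V (Fin.last m)).map
        Fin.castSuccEmb := by
    ext i
    simp only [Finset.mem_map, Finset.mem_filter, Finset.mem_univ, true_and, Fin.coe_castSuccEmb]
    constructor
    · rintro ⟨h1, h2⟩
      exact ⟨⟨i, h1⟩, h2, rfl⟩
    · rintro ⟨a, h, rfl⟩
      exact ⟨Fin.castSucc_lt_last a, h⟩
  rw [this, Finset.card_map, ← Finset.card_image_of_injective _ hinj]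
  congr 1
  ext p
  simp only [Finset.mem_inter, Finset.mem_image, Finset.mem_univ, true_and, Finset.mem_filter]
  constructor
  · rintro ⟨⟨i, rfl⟩, h⟩
    refine ⟨i, ?_, rfl⟩
    rcases hV _ _ (Fin.castSucc_lt_last i) with h' | h'
    · exact h'
    · exact absurd h (Finset.disjoint_left.1 h' (hmem i))
  · rintro ⟨i, h, rfl⟩
    exact ⟨⟨i, rfl⟩, h (hmem i)⟩

lemma card_injs_eq_prod {m : ℕ} {V : Fin m → Finset (Fin n)} (hV : Laminar V) :
    (injs V).card = ∏ j, choices V j := by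
  induction m with
  | zero =>
    have : injs V = Finset.univ := by
      ext f
      simp only [mem_injs, Function.injective_of_subsingleton, IsEmpty.forall_iff, and_self,
        Finset.mem_univ]
    simp [this]
  | succ m ih =>
    have hV' : Laminar fun i => V (Fin.castSucc i) := fun i j h => hV _ _ (by simpa using h)
    rw [Fin.prod_univ_castSucc]
    simp_rw [← choices_castSucc]
    rw [← ih hV', ← smul_eq_mul, ← Finset.sum_const,
      ← Finset.sum_congr rfl fun f hf => card_sdiff_image_eq_choices_last hV hf,
      ← Finset.card_sigma]
    refine Finset.card_bij' (fun f _ => ⟨fun i => f i.castSucc, f (Fin.last m)⟩)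
      (fun a _ => Fin.snoc (α := fun _ => Fin n) a.1 a.2) ?_ ?_ ?_ ?_
    · intro f hf
      obtain ⟨hinj, hmem⟩ := mem_injs.1 hf
      simp only [Finset.mem_sigma, Finset.mem_sdiff, Finset.mem_image, Finset.mem_univ, true_and,
        mem_injs]
      refine ⟨⟨fun a b h => by simpa using hinj h, fun j => hmem _⟩, hmem _, ?_⟩
      rintro ⟨a, h⟩
      exact absurd (hinj h) (Fin.castSucc_lt_last a).ne
    · rintro ⟨f, p⟩ h
      simp only [Finset.mem_sigma, Finset.mem_sdiff, Finset.mem_image, Finset.mem_univ, true_and,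
        mem_injs, not_exists] at h ⊢
      obtain ⟨⟨hinj, hmem⟩, hp, hne⟩ := h
      refine ⟨?_, fun j => ?_⟩
      · rw [Fin.snoc_injective_iff]
        exact ⟨hinj, by simpa using hne⟩
      · refine Fin.lastCases ?_ (fun i => ?_) j
        · simpa using hp
        · simpa using hmem i
    · intro f _
      exact Fin.snoc_init_self f
    · rintro ⟨f, p⟩ _
      simp

lemma card_perms_eq_prod {V : Fin n → Finset (Fin n)} (hV : Laminar V) :
    (perms V).card = ∏ j, choices V j := by
  rw [← card_injs_eq_prod hV]
  refine Finset.card_bij (fun π _ => ⇑π) ?_ ?_ ?_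
  · intro π h
    exact mem_injs.2 ⟨π.injective, mem_perms.1 h⟩
  · intro a _ b _ h
    exact DFunLike.coe_injective h
  · intro f h
    obtain ⟨hinj, hmem⟩ := mem_injs.1 h
    exact ⟨Equiv.ofBijective f (Finite.injective_iff_bijective.1 hinj), mem_perms.2 hmem, rfl⟩

/-- `choices V j` depends only on the candidate sets up to `j`, the earlier ones only through
whether they are contained in `V j`. -/
lemma choices_congr {m : ℕ} {V W : Fin m → Finset (Fin n)} {j : Fin m} (hj : V j = W j)
    (h : ∀ i < j, V i ⊆ V j ↔ W i ⊆ W j) : choices V j = choices W j := by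
  unfold choices
  rw [hj]
  congr 2
  ext i
  simp only [Finset.mem_filter, Finset.mem_univ, true_and]
  rw [← hj]
  constructor
  · rintro ⟨h1, h2⟩
    exact ⟨h1, hj ▸ (h i h1).1 h2⟩
  · rintro ⟨h1, h2⟩
    exact ⟨h1, (h i h1).2 (hj ▸ h2)⟩

/-- Shrinking nonempty earlier candidate sets does not change `choices`. -/
lemma choices_congr_of_subset {V W : Fin n → Finset (Fin n)} (hV : Laminar V) {j : Fin n}
    (hj : V j = W j) (h : ∀ i < j, W i ⊆ V i) (hne : ∀ i < j, (W i).Nonempty) :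
    choices V j = choices W j := by
  refine choices_congr hj fun i hi => ⟨fun h' => hj ▸ (h i hi).trans h', fun h' => ?_⟩
  rcases hV i j hi with h1 | h1
  · exact h1
  · obtain ⟨p, hp⟩ := hne i hi
    exact absurd (hj ▸ h' hp) (Finset.disjoint_left.1 h1 (h i hi hp))

lemma card_perms_mul_choices {V W : Fin n → Finset (Fin n)} (hV : Laminar V) (hW : Laminar W)
    (j : Fin n) (hne : ∀ i ≠ j, W i = V i) (hj : W j ⊆ V j) :
    (perms W).card * choices V j = (perms V).card * choices W j := by
  rcases (W j).eq_empty_or_nonempty with h0 | h0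
  · have h1 : choices W j = 0 := by simp [choices, h0]
    have h2 : perms W = ∅ := by
      refine Finset.eq_empty_of_forall_notMem fun π hπ => ?_
      have := mem_perms.1 hπ j
      simp [h0] at this
    simp [h1, h2]
  · rw [card_perms_eq_prod hV, card_perms_eq_prod hW,
      ← Finset.mul_prod_erase _ _ (Finset.mem_univ j),
      ← Finset.mul_prod_erase _ (choices V) (Finset.mem_univ j)]
    have : ∏ k ∈ Finset.univ.erase j, choices W k = ∏ k ∈ Finset.univ.erase j, choices V k := by
      refine Finset.prod_congr rfl fun k hk => ?_
      have hkj : k ≠ j := Finset.ne_of_mem_erase hk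
      refine choices_congr (hne k hkj) fun i hi => ?_
      rw [hne k hkj]
      by_cases hij : i = j
      · subst hij
        refine ⟨fun h => ?_, fun h => hj.trans h⟩
        rcases hV i k hi with h' | h'
        · exact h'
        · obtain ⟨p, hp⟩ := h0
          exact absurd (h hp) (Finset.disjoint_left.1 h' (hj hp))
      · rw [hne i hij]
    rw [this]
    ring

lemma choices_pos {V : Fin n → Finset (Fin n)} (hV : Laminar V) (h : (perms V).Nonempty)
    (j : Fin n) : 0 < choices V j := by
  have := Finset.card_pos.2 h
  rw [card_perms_eq_prod hV] at this
  exact Nat.pos_of_ne_zero fun h0 =>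
    this.ne' (Finset.prod_eq_zero (Finset.mem_univ j) h0)

lemma choices_le_card (V : Fin n → Finset (Fin n)) (j : Fin n) : choices V j ≤ (V j).card :=
  Nat.sub_le _ _

lemma choices_le (V : Fin n → Finset (Fin n)) (j : Fin n) : choices V j ≤ n :=
  (choices_le_card V j).trans (by simpa using Finset.card_le_univ (V j))

lemma choices_eq_of_eq_univ {V : Fin n → Finset (Fin n)} {j : Fin n} (h : V j = Finset.univ) :
    choices V j = n - j := by
  have : (Finset.univ.filter fun i => i < j) = Finset.Iio j := by
    ext i
    simp
  simp [choices, h, this]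

/-! ### Secrets with alternating bits -/

lemma le_score_iff (s : Secret n) (x : Fin n → Bool) (i : ℕ) :
    i ≤ (score s x : ℕ) ↔ i ≤ n ∧ ∀ j : Fin n, (j : ℕ) < i → s.1 (s.2 j) = x (s.2 j) := by
  constructor
  · intro h
    refine ⟨h.trans (Nat.findGreatest_le n), fun j hj => ?_⟩
    have := Nat.findGreatest_spec (P := fun i => ∀ j : Fin n, (j : ℕ) < i →
      s.1 (s.2 j) = x (s.2 j)) (Nat.zero_le n) (by simp)
    exact this j (lt_of_lt_of_le hj h)
  · rintro ⟨h1, h2⟩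
    exact Nat.le_findGreatest h1 h2

/-- The secret with permutation `π` whose bits alternate along `π`. -/
def altSecret (π : Equiv.Perm (Fin n)) : Secret n :=
  (fun p => (π.symm p : ℕ).bodd, π)

/-- The score of a query on the alternating secret of `π`. -/
def altScore (π : Equiv.Perm (Fin n)) (x : Fin n → Bool) : ℕ := score (altSecret π) x

lemma le_altScore_iff {π : Equiv.Perm (Fin n)} {x : Fin n → Bool} {i : ℕ} :
    i ≤ altScore π x ↔ i ≤ n ∧ ∀ j : Fin n, (j : ℕ) < i → x (π j) = (j : ℕ).bodd := by
  simp [altScore, le_score_iff, altSecret, eq_comm]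

lemma altScore_le (π : Equiv.Perm (Fin n)) (x : Fin n → Bool) : altScore π x ≤ n :=
  (le_altScore_iff.1 le_rfl).1

/-- The positions at which the query `x` carries the bit that belongs to index `j`. -/
def agree (x : Fin n → Bool) (j : ℕ) : Finset (Fin n) :=
  Finset.univ.filter fun p => x p = j.bodd

lemma mem_agree {x : Fin n → Bool} {j : ℕ} {p : Fin n} : p ∈ agree x j ↔ x p = j.bodd := by
  simp [agree]

/-- The candidate sets after learning that the score of `x` is at least `s`. -/
def atLeast (V : Fin n → Finset (Fin n)) (x : Fin n → Bool) (s : ℕ) (j : Fin n) :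
    Finset (Fin n) :=
  if (j : ℕ) < s then V j ∩ agree x j else V j

/-- The candidate sets after learning that the score of `x` is `s`. -/
def answer (V : Fin n → Finset (Fin n)) (x : Fin n → Bool) (s : ℕ) (j : Fin n) :
    Finset (Fin n) :=
  if (j : ℕ) < s then V j ∩ agree x j else if (j : ℕ) = s then V j \ agree x j else V j

lemma mem_perms_atLeast {V : Fin n → Finset (Fin n)} {x : Fin n → Bool} {s : ℕ} (hs : s ≤ n)
    {π : Equiv.Perm (Fin n)} :
    π ∈ perms (atLeast V x s) ↔ π ∈ perms V ∧ s ≤ altScore π x := by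
  simp only [mem_perms, le_altScore_iff, hs, true_and, ← forall_and]
  refine forall_congr' fun j => ?_
  unfold atLeast
  split_ifs with h <;> simp [h, mem_agree]

lemma mem_perms_answer {V : Fin n → Finset (Fin n)} {x : Fin n → Bool} {s : ℕ} (hs : s ≤ n)
    {π : Equiv.Perm (Fin n)} :
    π ∈ perms (answer V x s) ↔ π ∈ perms V ∧ altScore π x = s := by
  have key : π ∈ perms (answer V x s) ↔ π ∈ perms (atLeast V x s) ∧
      ∀ j : Fin n, (j : ℕ) = s → ¬ x (π j) = (j : ℕ).bodd := by
    simp only [mem_perms, ← forall_and]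
    refine forall_congr' fun j => ?_
    unfold atLeast answer
    split_ifs with h h' <;> simp_all [mem_agree]
    omega
  rw [key, mem_perms_atLeast hs, and_assoc]
  refine and_congr_right fun _ => ⟨fun ⟨h1, h2⟩ => ?_, fun h => ⟨h.ge, fun j hj hx => ?_⟩⟩
  · refine le_antisymm (not_lt.1 fun h => ?_) h1
    have h3 := le_altScore_iff.1 (Nat.succ_le_of_lt h)
    exact h2 ⟨s, h3.1⟩ rfl (h3.2 ⟨s, h3.1⟩ (Nat.lt_succ_self s))
  · have h1 := le_altScore_iff.1 h.ge
    have : s + 1 ≤ altScore π x := le_altScore_iff.2 ⟨by omega, fun i hi => by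
      rcases Nat.lt_succ_iff_lt_or_eq.1 hi with h' | h'
      · exact h1.2 i h'
      · have : i = j := Fin.ext (by omega)
        rw [this, hx]⟩
    omega

lemma atLeast_subset (V : Fin n → Finset (Fin n)) (x : Fin n → Bool) (s : ℕ) (j : Fin n) :
    atLeast V x s j ⊆ V j := by
  unfold atLeast
  split_ifs
  exacts [Finset.inter_subset_left, subset_rfl]

lemma answer_subset (V : Fin n → Finset (Fin n)) (x : Fin n → Bool) (s : ℕ) (j : Fin n) :
    answer V x s j ⊆ V j := by
  unfold answer
  split_ifs
  exacts [Finset.inter_subset_left, Finset.sdiff_subset, subset_rfl]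

lemma bodd_eq_or_not (a b : ℕ) : a.bodd = b.bodd ∨ a.bodd = !b.bodd := by
  cases a.bodd <;> cases b.bodd <;> simp

lemma Laminar.atLeast {V : Fin n → Finset (Fin n)} (hV : Laminar V) (x : Fin n → Bool) (s : ℕ) :
    Laminar (atLeast V x s) := by
  intro i j hij
  have hij' : (i : ℕ) < j := hij
  rcases hV i j hij with h | h
  · unfold PermMastermind.atLeast
    by_cases hj : (j : ℕ) < s
    · rw [if_pos (hij'.trans hj), if_pos hj]
      rcases bodd_eq_or_not i j with hb | hb
      · left
        intro p
        simp only [Finset.mem_inter, mem_agree, hb]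
        exact fun hp => ⟨h hp.1, hp.2⟩
      · right
        rw [Finset.disjoint_left]
        intro p
        simp only [Finset.mem_inter, mem_agree, hb]
        rintro ⟨-, hp⟩ ⟨-, hp'⟩
        rw [hp] at hp'
        simp at hp'
    · left
      rw [if_neg hj]
      exact (atLeast_subset V x s i).trans h
  · exact Or.inr (h.mono (atLeast_subset V x s i) (atLeast_subset V x s j))

lemma Laminar.answer {V : Fin n → Finset (Fin n)} (hV : Laminar V) (x : Fin n → Bool) (s : ℕ) :
    Laminar (answer V x s) := by
  intro i j hij
  have hij' : (i : ℕ) < j := hij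
  rcases hV i j hij with h | h
  · rcases lt_trichotomy (j : ℕ) s with hj | hj | hj
    · have := hV.atLeast x s i j hij
      unfold PermMastermind.atLeast at this
      unfold PermMastermind.answer
      simpa [hij'.trans hj, hj] using this
    · unfold PermMastermind.answer
      rw [if_pos (hij'.trans_eq hj), if_neg (by omega), if_pos hj]
      rcases bodd_eq_or_not i j with hb | hb
      · right
        rw [Finset.disjoint_left]
        intro p
        simp only [Finset.mem_inter, Finset.mem_sdiff, mem_agree, hb]
        tauto
      · left
        intro p
        simp only [Finset.mem_inter, Finset.mem_sdiff, mem_agree, hb]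
        exact fun hp => ⟨h hp.1, by rw [hp.2]; simp⟩
    · left
      have : PermMastermind.answer V x s j = V j := by
        unfold PermMastermind.answer
        rw [if_neg (by omega), if_neg (by omega)]
      rw [this]
      exact (answer_subset V x s i).trans h
  · exact Or.inr (h.mono (answer_subset V x s i) (answer_subset V x s j))

lemma disjoint_answer {V : Fin n → Finset (Fin n)} {x : Fin n → Bool} {i j : Fin n}
    (hij : i < j) (hb : (i : ℕ).bodd = (j : ℕ).bodd) :
    Disjoint (answer V x j i) (answer V x j j) := by
  have hij' : (i : ℕ) < j := hij
  unfold answer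
  rw [if_pos hij', if_neg (lt_irrefl _), if_pos rfl, Finset.disjoint_left]
  intro p
  simp only [Finset.mem_inter, Finset.mem_sdiff, mem_agree, hb]
  tauto

/-! ### The distribution of the score of one query -/

/-- The number of consistent permutations on which `x` scores at least `j`. -/
def numGe (V : Fin n → Finset (Fin n)) (x : Fin n → Bool) (j : ℕ) : ℕ :=
  ((perms V).filter fun π => j ≤ altScore π x).card

/-- The number of consistent permutations on which `x` scores exactly `j`. -/
def numEq (V : Fin n → Finset (Fin n)) (x : Fin n → Bool) (j : ℕ) : ℕ :=
  ((perms V).filter fun π => altScore π x = j).card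

lemma numEq_add_numGe_succ (V : Fin n → Finset (Fin n)) (x : Fin n → Bool) (j : ℕ) :
    numEq V x j + numGe V x (j + 1) = numGe V x j := by
  unfold numEq numGe
  rw [← Finset.card_union_of_disjoint]
  · congr 1
    ext π
    simp only [Finset.mem_union, Finset.mem_filter, ← and_or_left]
    refine and_congr_right fun _ => ?_
    omega
  · rw [Finset.disjoint_left]
    intro π
    simp only [Finset.mem_filter]
    omega

lemma numGe_le (V : Fin n → Finset (Fin n)) (x : Fin n → Bool) (j : ℕ) :
    numGe V x j ≤ (perms V).card :=
  Finset.card_filter_le _ _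

lemma card_perms_atLeast (V : Fin n → Finset (Fin n)) (x : Fin n → Bool) {j : ℕ} (hj : j ≤ n) :
    (perms (atLeast V x j)).card = numGe V x j := by
  unfold numGe
  congr 1
  ext π
  rw [mem_perms_atLeast hj, Finset.mem_filter]

lemma card_perms_answer (V : Fin n → Finset (Fin n)) (x : Fin n → Bool) {j : ℕ} (hj : j ≤ n) :
    (perms (answer V x j)).card = numEq V x j := by
  unfold numEq
  congr 1
  ext π
  rw [mem_perms_answer hj, Finset.mem_filter]

lemma nonempty_of_perms {V : Fin n → Finset (Fin n)} (h : (perms V).Nonempty) (i : Fin n) :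
    (V i).Nonempty := by
  obtain ⟨π, hπ⟩ := h
  exact ⟨π i, mem_perms.1 hπ i⟩

lemma choices_atLeast_self {V : Fin n → Finset (Fin n)} (hV : Laminar V) (x : Fin n → Bool)
    {j : Fin n} (h : 0 < numGe V x j) : choices (atLeast V x j) j = choices V j := by
  rw [← card_perms_atLeast V x j.isLt.le, Finset.card_pos] at h
  refine (choices_congr_of_subset hV (by simp [atLeast]) (fun i _ => atLeast_subset V x j i)
    fun i _ => nonempty_of_perms h i).symm

/-- The conditional probability that the score is `j`, given that it is at least `j`. -/
lemma numEq_mul_choices {V : Fin n → Finset (Fin n)} (hV : Laminar V) (x : Fin n → Bool)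
    (j : Fin n) : numEq V x j * choices V j = numGe V x j * choices (answer V x j) j := by
  rcases Nat.eq_zero_or_pos (numGe V x j) with h | h
  · have := numEq_add_numGe_succ V x j
    have h' : numEq V x j = 0 := by omega
    simp [h, h']
  · have := card_perms_mul_choices (hV.atLeast x j) (hV.answer x j) j (fun i hi => ?_) ?_
    · rwa [card_perms_atLeast V x j.isLt.le, card_perms_answer V x j.isLt.le,
        choices_atLeast_self hV x h] at this
    · have : (i : ℕ) ≠ j := fun h => hi (Fin.ext h)
      simp [atLeast, answer, this]
    · simp [atLeast, answer]

/-- The conditional probability that the score is above `j`, given that it is at least `j`. -/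
lemma numGe_succ_mul_choices {V : Fin n → Finset (Fin n)} (hV : Laminar V) (x : Fin n → Bool)
    (j : Fin n) : numGe V x (j + 1) * choices V j =
      numGe V x j * choices (atLeast V x (j + 1)) j := by
  rcases Nat.eq_zero_or_pos (numGe V x j) with h | h
  · have := numEq_add_numGe_succ V x j
    have h' : numGe V x (j + 1) = 0 := by omega
    simp [h, h']
  · have := card_perms_mul_choices (hV.atLeast x j) (hV.atLeast x (j + 1)) j (fun i hi => ?_) ?_
    · rwa [card_perms_atLeast V x j.isLt.le, card_perms_atLeast V x j.isLt,
        choices_atLeast_self hV x h] at this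
    · have : (i : ℕ) ≠ j := fun h => hi (Fin.ext h)
      have h2 : (i : ℕ) < j + 1 ↔ (i : ℕ) < j := by omega
      simp [atLeast, h2]
    · simp [atLeast]

/-- A score above `j` reduces the choices for `j` to those that agree with the query. -/
lemma choices_answer_of_gt (V : Fin n → Finset (Fin n)) (x : Fin n → Bool) {j : Fin n} {s : ℕ}
    (h : (j : ℕ) < s) : choices (answer V x s) j = choices (atLeast V x (j + 1)) j := by
  refine choices_congr (by simp [answer, atLeast, h]) fun i hi => ?_
  have hi' : (i : ℕ) < j := hi
  simp [answer, atLeast, h, hi'.trans h, Nat.lt_succ_of_lt hi']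

/-- A score below `j` does not change the choices for `j`. -/
lemma choices_answer_of_lt {V : Fin n → Finset (Fin n)} (hV : Laminar V) (x : Fin n → Bool)
    {j : Fin n} {s : ℕ} (h : s < j) (hne : 0 < numEq V x s) :
    choices (answer V x s) j = choices V j := by
  rw [← card_perms_answer V x (h.le.trans j.isLt.le), Finset.card_pos] at hne
  refine (choices_congr_of_subset hV ?_ (fun i _ => answer_subset V x s i)
    fun i _ => nonempty_of_perms hne i).symm
  unfold answer
  rw [if_neg (by omega), if_neg (by omega)]

/-- If the indices `j` and `j + 1` are unconstrained, then the score is `j` at least as often as it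
is at least `j + 2`. -/
lemma numGe_add_two_le {V : Fin n → Finset (Fin n)} (x : Fin n → Bool) {j : ℕ} (hj : j + 2 ≤ n)
    (h : ∀ i : Fin n, j ≤ i → V i = Finset.univ) : numGe V x (j + 2) ≤ numEq V x j := by
  set a : Fin n := ⟨j, by omega⟩ with ha
  set b : Fin n := ⟨j + 1, by omega⟩ with hb
  refine Finset.card_le_card_of_injOn (fun π => π * Equiv.swap a b) ?_
    fun _ _ _ _ h => mul_right_cancel h
  intro π hπ
  simp only [Finset.coe_filter, Set.mem_ofPred_eq, le_altScore_iff] at hπ ⊢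
  obtain ⟨h1, -, h2⟩ := hπ
  have hlow : ∀ i : Fin n, (i : ℕ) < j → (π * Equiv.swap a b) i = π i := by
    intro i hi
    rw [Equiv.Perm.mul_apply, Equiv.swap_apply_of_ne_of_ne]
    · rintro rfl; simp [ha] at hi
    · rintro rfl; simp [hb] at hi
  refine ⟨mem_perms.2 fun i => ?_, ?_⟩
  · rcases lt_or_ge (i : ℕ) j with hi | hi
    · rw [hlow i hi]
      exact mem_perms.1 h1 i
    · rw [h i hi]
      exact Finset.mem_univ _
  · refine le_antisymm (not_lt.1 fun hlt => ?_) (le_altScore_iff.2 ⟨by omega, fun i hi => ?_⟩)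
    · have h3 := (le_altScore_iff.1 (Nat.succ_le_of_lt hlt)).2 a (by simp [ha])
      rw [Equiv.Perm.mul_apply, Equiv.swap_apply_left, h2 b (by simp [hb])] at h3
      simp [ha, hb] at h3
    · rw [hlow i hi]
      exact h2 i (by omega)

/-! ### The potential of a candidate set -/

/-- The potential of an index with `N` remaining choices. -/
noncomputable def pot (n : ℕ) (N : ℝ) : ℝ := Real.log (1 + Real.log (2 * n / N))

lemma pot_nonneg {N : ℝ} (hN : 0 ≤ N) (h : N ≤ n) : 0 ≤ pot n N := by
  rcases hN.eq_or_lt with h0 | h0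
  · simp [pot, ← h0]
  · refine Real.log_nonneg ?_
    have : 0 ≤ Real.log (2 * n / N) := Real.log_nonneg (by rw [le_div_iff₀ h0]; linarith)
    linarith

lemma pot_sub_le {N p : ℝ} (hN : 0 < N) (h : N ≤ n) (hp : 0 < p) (hp1 : p ≤ 1) :
    pot n (p * N) - pot n N ≤ -Real.log p / (1 + Real.log (2 * n / N)) := by
  have hn : (0 : ℝ) < 2 * n := by linarith
  have hL : 0 ≤ Real.log (2 * n / N) := Real.log_nonneg (by rw [le_div_iff₀ hN]; linarith)
  have hu : 0 ≤ -Real.log p := neg_nonneg.2 (Real.log_nonpos hp.le hp1)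
  unfold pot
  rw [show 2 * n / (p * N) = 2 * n / N / p by field_simp,
    Real.log_div (div_pos hn hN).ne' hp.ne']
  set L := Real.log (2 * n / N)
  rw [← Real.log_div (by linarith) (by linarith)]
  refine (Real.log_le_sub_one_of_pos (div_pos (by linarith) (by linarith))).trans_eq ?_
  have : 1 + L ≠ 0 := by linarith
  field_simp
  ring

lemma mul_pot_sub_le_one_sub {N q : ℝ} (hN : 0 < N) (h : N ≤ n) (hq : 0 < q) (hq1 : q ≤ 1) :
    q * (pot n (q * N) - pot n N) ≤ 1 - q := by
  have hL : 0 ≤ Real.log (2 * n / N) := Real.log_nonneg (by rw [le_div_iff₀ hN]; linarith)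
  have hu : 0 ≤ -Real.log q := neg_nonneg.2 (Real.log_nonpos hq.le hq1)
  have h1 : pot n (q * N) - pot n N ≤ -Real.log q :=
    (pot_sub_le hN h hq hq1).trans (div_le_self hu (by linarith))
  have h2 : -Real.log q ≤ q⁻¹ - 1 := by
    rw [← Real.log_inv]
    exact Real.log_le_sub_one_of_pos (inv_pos.2 hq)
  calc q * (pot n (q * N) - pot n N) ≤ q * (q⁻¹ - 1) :=
        mul_le_mul_of_nonneg_left (h1.trans h2) hq.le
    _ = 1 - q := by field_simp

lemma mul_pot_sub_le_two_mul_add {N p : ℝ} (hN : 0 < N) (h : N ≤ n) (hp : 0 < p)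
    (hp1 : p ≤ 1) : p * (pot n (p * N) - pot n N) ≤ 2 * p + N / (2 * n) := by
  have hn : (0 : ℝ) < 2 * n := by linarith
  have hL : 0 ≤ Real.log (2 * n / N) := Real.log_nonneg (by rw [le_div_iff₀ hN]; linarith)
  have hu : 0 ≤ -Real.log p := neg_nonneg.2 (Real.log_nonpos hp.le hp1)
  have h1 := pot_sub_le hN h hp hp1
  have hNn : 0 ≤ N / (2 * n) := by positivity
  set L := Real.log (2 * n / N) with hLdef
  rcases le_or_gt (-Real.log p) (2 * (1 + L)) with hc | hc
  · have : -Real.log p / (1 + L) ≤ 2 := by rwa [div_le_iff₀ (by linarith)]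
    nlinarith [mul_le_mul_of_nonneg_left (h1.trans this) hp.le]
  · have h2 : pot n (p * N) - pot n N ≤ -Real.log p := h1.trans (div_le_self hu (by linarith))
    set u := -Real.log p with hudef
    have hpu : p = Real.exp (-u / 2) * Real.exp (-u / 2) := by
      rw [← Real.exp_add, show -u / 2 + -u / 2 = Real.log p by rw [hudef]; ring, Real.exp_log hp]
    have hue : u ≤ Real.exp (u / 2) := by
      have h3 := Real.quadratic_le_exp_of_nonneg (x := u / 2) (by linarith)
      nlinarith [sq_nonneg (u / 2 - 1)]
    have h4 : Real.exp (-u / 2) ≤ N / (2 * n) := by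
      rw [← Real.exp_log (show 0 < N / (2 * n) by positivity), Real.exp_le_exp,
        show N / (2 * n) = (2 * n / N)⁻¹ by rw [inv_div], Real.log_inv, ← hLdef]
      linarith
    calc p * (pot n (p * N) - pot n N) ≤ p * u := by gcongr
      _ ≤ p * Real.exp (u / 2) := by gcongr
      _ = Real.exp (-u / 2) := by
        conv_lhs => rw [hpu]
        rw [mul_assoc, ← Real.exp_add, show -u / 2 + u / 2 = 0 by ring, Real.exp_zero, mul_one]
      _ ≤ 2 * p + N / (2 * n) := by linarith

lemma pot_le_three {N : ℝ} (hN : 0 < N) (h : N ≤ n) (h8 : n ≤ 8 * N) : pot n N ≤ 3 := by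
  have hL : 0 ≤ Real.log (2 * n / N) := Real.log_nonneg (by rw [le_div_iff₀ hN]; linarith)
  have h1 : Real.log (2 * n / N) ≤ Real.log (2 ^ 4) :=
    Real.log_le_log (div_pos (by linarith) hN) (by rw [div_le_iff₀ hN]; linarith)
  rw [Real.log_pow] at h1
  have h2 := Real.log_two_lt_d9
  refine (Real.log_le_sub_one_of_pos (by linarith)).trans ?_
  push_cast at h1
  linarith

/-- The expected change of the potential of one index, with weights `e` for failing, `c'` for
passing and `c = e + c'`. -/
lemma pot_drift {e c c' N F P : ℕ} (he : e * N = c * F) (hc' : c' * N = c * P)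
    (hc : e + c' = c) (hN : 0 < N) (hNn : N ≤ n) :
    (e : ℝ) * (pot n F - pot n N) + c' * (pot n P - pot n N) ≤ 3 * e + c * (N / (2 * n)) := by
  have hNr : (0 : ℝ) < N := by exact_mod_cast hN
  have hNnr : (N : ℝ) ≤ n := by exact_mod_cast hNn
  rcases Nat.eq_zero_or_pos c with h0 | h0
  · have h1 : e = 0 := by omega
    have h2 : c' = 0 := by omega
    simp [h0, h1, h2]
  have hcr : (0 : ℝ) < c := by exact_mod_cast h0
  have her : (e : ℝ) * N = c * F := by exact_mod_cast he
  have hcr' : (c' : ℝ) * N = c * P := by exact_mod_cast hc'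
  have hsum : (e : ℝ) + c' = c := by exact_mod_cast hc
  have hF : (F : ℝ) = e / c * N := by field_simp; linarith
  have hP : (P : ℝ) = c' / c * N := by field_simp; linarith
  have hNn0 : (0 : ℝ) ≤ N / (2 * n) := by positivity
  have A : (e : ℝ) * (pot n F - pot n N) ≤ 2 * e + c * (N / (2 * n)) := by
    rcases Nat.eq_zero_or_pos e with h1 | h1
    · simp only [h1, Nat.cast_zero, zero_mul, mul_zero, zero_add]
      positivity
    · have h1r : (0 : ℝ) < e := by exact_mod_cast h1
      have := mul_pot_sub_le_two_mul_add hNr hNnr (p := e / c) (by positivity)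
        (by rw [div_le_one hcr, ← hsum]; linarith [Nat.cast_nonneg (α := ℝ) c'])
      rw [← hF] at this
      have h2 := mul_le_mul_of_nonneg_left this hcr.le
      have e1 : (c : ℝ) * (e / c * (pot n F - pot n N)) = e * (pot n F - pot n N) := by
        field_simp
      have e2 : (c : ℝ) * (2 * (e / c) + N / (2 * n)) = 2 * e + c * (N / (2 * n)) := by
        rw [mul_add]
        congr 1
        field_simp
      rwa [e1, e2] at h2
  have B : (c' : ℝ) * (pot n P - pot n N) ≤ e := by
    rcases Nat.eq_zero_or_pos c' with h1 | h1
    · simp [h1]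
    · have h1r : (0 : ℝ) < c' := by exact_mod_cast h1
      have := mul_pot_sub_le_one_sub hNr hNnr (q := c' / c) (by positivity)
        (by rw [div_le_one hcr, ← hsum]; linarith [Nat.cast_nonneg (α := ℝ) e])
      rw [← hP] at this
      have h2 := mul_le_mul_of_nonneg_left this hcr.le
      have e1 : (c : ℝ) * (c' / c * (pot n P - pot n N)) = c' * (pot n P - pot n N) := by
        field_simp
      have e2 : (c : ℝ) * (1 - c' / c) = e := by
        field_simp
        linarith
      rwa [e1, e2] at h2
  linarith

/-! ### States of knowledge -/

/-- A state of knowledge: the candidate sets, a bound `top` such that the indices from `top` on are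
unconstrained, and the set of those indices that were scored when still unconstrained and kept many
choices. -/
structure State (n : ℕ) where
  cand : Fin n → Finset (Fin n)
  top : ℕ
  hits : Finset (Fin n)

namespace State

/-- The indices that become hits when `x` scores `s`. -/
def newHits (σ : State n) (x : Fin n → Bool) (s : ℕ) : Finset (Fin n) :=
  Finset.univ.filter fun j => (j : ℕ) = s ∧ σ.top ≤ j ∧ n ≤ 8 * choices (answer σ.cand x s) j

/-- The state after `x` has scored `s`. -/
def step (σ : State n) (x : Fin n → Bool) (s : ℕ) : State n where
  cand := answer σ.cand x s
  top := max σ.top (s + 1)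
  hits := σ.hits ∪ σ.newHits x s

/-- The invariants of the states that occur. -/
structure Valid (σ : State n) : Prop where
  laminar : Laminar σ.cand
  fresh : ∀ j : Fin n, σ.top ≤ j → σ.cand j = Finset.univ
  hits_lt : ∀ j ∈ σ.hits, (j : ℕ) < σ.top
  disjoint : ∀ i j : Fin n, j ∈ σ.hits → i < j → (i : ℕ).bodd = (j : ℕ).bodd →
    Disjoint (σ.cand i) (σ.cand j)

/-- The total potential of the hits. -/
noncomputable def potential (σ : State n) : ℝ :=
  ∑ j ∈ σ.hits, pot n (choices σ.cand j)

lemma Valid.step {σ : State n} (h : σ.Valid) (x : Fin n → Bool) (s : ℕ) : (σ.step x s).Valid where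
  laminar := h.laminar.answer x s
  fresh j hj := by
    simp only [State.step, max_le_iff] at hj ⊢
    unfold answer
    rw [if_neg (by omega), if_neg (by omega)]
    exact h.fresh j hj.1
  hits_lt j hj := by
    simp only [State.step, newHits, Finset.mem_union, Finset.mem_filter, Finset.mem_univ,
      true_and, lt_max_iff] at hj ⊢
    rcases hj with hj | hj
    · exact Or.inl (h.hits_lt j hj)
    · right
      omega
  disjoint i j hj hij hb := by
    simp only [State.step, newHits, Finset.mem_union, Finset.mem_filter, Finset.mem_univ,
      true_and] at hj ⊢
    rcases hj with hj | ⟨rfl, -⟩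
    · exact (h.disjoint i j hj hij hb).mono (answer_subset _ _ _ _) (answer_subset _ _ _ _)
    · exact disjoint_answer hij hb

lemma card_newHits_le_one (σ : State n) (x : Fin n → Bool) (s : ℕ) :
    (σ.newHits x s).card ≤ 1 := by
  refine Finset.card_le_one.2 fun a ha b hb => ?_
  simp only [newHits, Finset.mem_filter, Finset.mem_univ, true_and] at ha hb
  exact Fin.ext (by omega)

/-- Hits of equal parity have disjoint candidate sets, so the choices of all hits add up to at most
`2 * n`. -/
lemma Valid.sum_choices_le {σ : State n} (h : σ.Valid) :
    ∑ j ∈ σ.hits, choices σ.cand j ≤ 2 * n := by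
  have key : ∀ b : Bool, ∑ j ∈ σ.hits.filter (fun j : Fin n => (j : ℕ).bodd = b),
      choices σ.cand j ≤ n := by
    intro b
    refine (Finset.sum_le_sum fun j _ => choices_le_card σ.cand j).trans ?_
    rw [← Finset.card_biUnion]
    · simpa using Finset.card_le_univ ((σ.hits.filter fun j : Fin n => (j : ℕ).bodd = b).biUnion
        σ.cand)
    · intro i hi j hj hij
      simp only [Finset.coe_filter, Set.mem_ofPred_eq] at hi hj
      rcases lt_or_gt_of_ne hij with h' | h'
      · exact h.disjoint i j hj.1 h' (hi.2.trans hj.2.symm)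
      · exact (h.disjoint j i hi.1 h' (hj.2.trans hi.2.symm)).symm
  have := Finset.sum_filter_add_sum_filter_not σ.hits (fun j : Fin n => (j : ℕ).bodd = true)
    (choices σ.cand)
  simp only [Bool.not_eq_true] at this
  rw [← this, two_mul]
  exact add_le_add (key true) (key false)

end State

/-! ### Drift -/

lemma sum_numEq_le {V : Fin n → Finset (Fin n)} (x : Fin n → Bool) (H : Finset (Fin n)) :
    ∑ j ∈ H, numEq V x j ≤ (perms V).card := by
  have h1 : ∀ k, ∑ j ∈ Finset.range k, numEq V x j + numGe V x k = numGe V x 0 := by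
    intro k
    induction k with
    | zero => simp
    | succ k ih => rw [Finset.sum_range_succ, add_assoc, numEq_add_numGe_succ, ih]
  calc ∑ j ∈ H, numEq V x j ≤ ∑ j : Fin n, numEq V x j :=
        Finset.sum_le_sum_of_subset (Finset.subset_univ H)
    _ = ∑ j ∈ Finset.range n, numEq V x j := Fin.sum_univ_eq_sum_range (numEq V x) n
    _ ≤ numGe V x 0 := (Nat.le_add_right _ _).trans_eq (h1 n)
    _ ≤ (perms V).card := numGe_le V x 0

lemma sum_pot_sub_le {V : Fin n → Finset (Fin n)} (hV : Laminar V) (x : Fin n → Bool)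
    (hne : (perms V).Nonempty) (j : Fin n) :
    ∑ π ∈ perms V, (pot n (choices (answer V x (altScore π x)) j) - pot n (choices V j)) ≤
      3 * numEq V x j + numGe V x j * (choices V j / (2 * n)) := by
  refine le_trans (le_of_eq ?_) (pot_drift (numEq_mul_choices hV x j)
    (numGe_succ_mul_choices hV x j) (numEq_add_numGe_succ V x j) (choices_pos hV hne j)
    (choices_le V j))
  set A := pot n (choices (answer V x j) j) - pot n (choices V j)
  set B := pot n (choices (atLeast V x (j + 1)) j) - pot n (choices V j)
  have : ∀ π ∈ perms V,
      pot n (choices (answer V x (altScore π x)) j) - pot n (choices V j) =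
        (if altScore π x = j then A else 0) + (if (j : ℕ) + 1 ≤ altScore π x then B else 0) := by
    intro π hπ
    rcases lt_trichotomy (altScore π x) j with h | h | h
    · rw [if_neg h.ne, if_neg (by omega), choices_answer_of_lt hV x h, sub_self, add_zero]
      exact Finset.card_pos.2 ⟨π, Finset.mem_filter.2 ⟨hπ, rfl⟩⟩
    · rw [if_pos h, if_neg (by omega), h, add_zero]
    · rw [if_neg h.ne', if_pos (by omega), choices_answer_of_gt V x h, zero_add]
  rw [Finset.sum_congr rfl this, Finset.sum_add_distrib, ← Finset.sum_filter, ← Finset.sum_filter,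
    Finset.sum_const, Finset.sum_const, nsmul_eq_mul, nsmul_eq_mul]
  rfl

namespace State

/-- One query increases the potential by at most a constant on average. -/
lemma Valid.sum_potential_step_sub_le {σ : State n} (h : σ.Valid) (x : Fin n → Bool) :
    ∑ π ∈ perms σ.cand, ((σ.step x (altScore π x)).potential - σ.potential) ≤
      7 * (perms σ.cand).card := by
  rcases (perms σ.cand).eq_empty_or_nonempty with h0 | hne
  · simp [h0]
  have hn0 : (0 : ℝ) ≤ 2 * n := by positivity
  have h1 : ∀ π ∈ perms σ.cand, (σ.step x (altScore π x)).potential - σ.potential ≤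
      ∑ j ∈ σ.hits, (pot n (choices (answer σ.cand x (altScore π x)) j) -
        pot n (choices σ.cand j)) + 3 := by
    intro π hπ
    set s := altScore π x
    have hpos : ∀ j, 0 < choices (answer σ.cand x s) j := fun j =>
      choices_pos (h.laminar.answer x s)
        ⟨π, (mem_perms_answer (altScore_le π x)).2 ⟨hπ, rfl⟩⟩ j
    have hle : ∀ j, ((choices (answer σ.cand x s) j : ℕ) : ℝ) ≤ n := fun j => by
      exact_mod_cast choices_le _ j
    have h2 : ∑ j ∈ σ.newHits x s, pot n (choices (answer σ.cand x s) j) ≤ 3 := by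
      refine (Finset.sum_le_card_nsmul _ _ 3 fun j hj => ?_).trans ?_
      · simp only [newHits, Finset.mem_filter, Finset.mem_univ, true_and] at hj
        exact pot_le_three (by exact_mod_cast hpos j) (hle j) (by exact_mod_cast hj.2.2)
      · have : ((σ.newHits x s).card : ℝ) ≤ 1 := by exact_mod_cast card_newHits_le_one σ x s
        rw [nsmul_eq_mul]
        linarith
    have h3 : (σ.step x s).potential ≤ ∑ j ∈ σ.hits, pot n (choices (answer σ.cand x s) j) +
        ∑ j ∈ σ.newHits x s, pot n (choices (answer σ.cand x s) j) := by
      rw [← Finset.sum_union_inter]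
      exact le_add_of_nonneg_right
        (Finset.sum_nonneg fun j _ => pot_nonneg (Nat.cast_nonneg _) (hle j))
    rw [Finset.sum_sub_distrib]
    unfold potential at h3 ⊢
    linarith
  refine (Finset.sum_le_sum h1).trans ?_
  rw [Finset.sum_add_distrib, Finset.sum_comm, Finset.sum_const, nsmul_eq_mul]
  have h4 := Finset.sum_le_sum fun j (_ : j ∈ σ.hits) => sum_pot_sub_le h.laminar x hne j
  have h5 : (∑ j ∈ σ.hits, (numEq σ.cand x j : ℝ)) ≤ (perms σ.cand).card := by
    exact_mod_cast sum_numEq_le x σ.hits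
  have h6 : ∑ j ∈ σ.hits, (numGe σ.cand x j : ℝ) * (choices σ.cand j / (2 * n)) ≤
      (perms σ.cand).card := by
    calc ∑ j ∈ σ.hits, (numGe σ.cand x j : ℝ) * (choices σ.cand j / (2 * n))
        ≤ ∑ j ∈ σ.hits, ((perms σ.cand).card : ℝ) * (choices σ.cand j / (2 * n)) := by
          gcongr
          exact numGe_le _ _ _
      _ = (perms σ.cand).card * ((∑ j ∈ σ.hits, (choices σ.cand j : ℝ)) / (2 * n)) := by
          rw [← Finset.mul_sum, Finset.sum_div]
      _ ≤ (perms σ.cand).card * 1 := by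
          gcongr
          refine div_le_one_of_le₀ ?_ hn0
          exact_mod_cast h.sum_choices_le
      _ = (perms σ.cand).card := mul_one _
  rw [Finset.sum_add_distrib, ← Finset.mul_sum] at h4
  linarith

lemma Valid.sum_top_step_le {σ : State n} (h : σ.Valid) (ht : σ.top < n) (x : Fin n → Bool) :
    ∑ π ∈ perms σ.cand, (σ.step x (altScore π x)).top ≤
      (perms σ.cand).card * σ.top + 3 * numGe σ.cand x σ.top := by
  have h1 : ∀ π ∈ perms σ.cand, (σ.step x (altScore π x)).top =
      σ.top + ∑ j ∈ Finset.Ico σ.top (n + 1), if j ≤ altScore π x then 1 else 0 := by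
    intro π _
    have := altScore_le π x
    rw [← Finset.card_filter]
    have : (Finset.Ico σ.top (n + 1)).filter (fun j => j ≤ altScore π x) =
        Finset.Ico σ.top (altScore π x + 1) := by
      ext j
      simp only [Finset.mem_filter, Finset.mem_Ico]
      omega
    rw [this, Nat.card_Ico]
    simp only [State.step]
    omega
  rw [Finset.sum_congr rfl h1, Finset.sum_add_distrib, Finset.sum_const, smul_eq_mul,
    Finset.sum_comm]
  refine Nat.add_le_add_left ?_ _
  simp_rw [← Finset.card_filter]
  change ∑ j ∈ Finset.Ico σ.top (n + 1), numGe σ.cand x j ≤ _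
  have h2 : ∀ k, σ.top ≤ k → k + 1 ≤ n →
      ∑ j ∈ Finset.Ico σ.top (k + 2), numGe σ.cand x j + numGe σ.cand x k ≤
        3 * numGe σ.cand x σ.top := by
    intro k hk
    induction k, hk using Nat.le_induction with
    | base =>
      intro _
      have := numEq_add_numGe_succ σ.cand x σ.top
      rw [Finset.sum_Ico_succ_top (by omega), Finset.sum_Ico_succ_top le_rfl]
      simp only [Finset.Ico_self, Finset.sum_empty]
      omega
    | succ k hk ih =>
      intro hkn
      have h3 := numEq_add_numGe_succ σ.cand x k
      have h4 := numGe_add_two_le (V := σ.cand) x (j := k) hkn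
        fun i hi => h.fresh i (hk.trans hi)
      have h5 := ih (by omega)
      rw [Finset.sum_Ico_succ_top (by omega)]
      omega
  have h6 := h2 (n - 1) (by omega) (by omega)
  rw [show n - 1 + 2 = n + 1 by omega] at h6
  omega

lemma numEq_le_sum_card_newHits (σ : State n) (x : Fin n → Bool) {j : Fin n} (hj : σ.top ≤ j)
    (h8 : n ≤ 8 * choices (answer σ.cand x j) j) :
    numEq σ.cand x j ≤ ∑ π ∈ perms σ.cand, (σ.newHits x (altScore π x)).card := by
  unfold numEq
  rw [Finset.card_filter]
  refine Finset.sum_le_sum fun π _ => ?_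
  split_ifs with h
  · refine Finset.card_pos.2 ⟨j, ?_⟩
    simp only [newHits, Finset.mem_filter, Finset.mem_univ, true_and]
    rw [h]
    exact ⟨rfl, hj, h8⟩
  · exact Nat.zero_le _

lemma Valid.numGe_top_le {σ : State n} (h : σ.Valid) (hn : 4 ≤ n) (ht : 2 * σ.top ≤ n)
    (x : Fin n → Bool) : numGe σ.cand x σ.top ≤
      4 * ∑ π ∈ perms σ.cand, (σ.newHits x (altScore π x)).card := by
  rcases Nat.eq_zero_or_pos (numGe σ.cand x σ.top) with h0 | h0
  · omega
  set a : Fin n := ⟨σ.top, by omega⟩ with ha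
  set b : Fin n := ⟨σ.top + 1, by omega⟩ with hb
  have e1 := numEq_add_numGe_succ σ.cand x σ.top
  have e2 : _ + numGe σ.cand x (σ.top + 2) = _ := numEq_add_numGe_succ σ.cand x (σ.top + 1)
  have e3 := numGe_add_two_le (V := σ.cand) x (j := σ.top) (by omega) h.fresh
  have e4 := numEq_mul_choices h.laminar x a
  have e5 := numEq_mul_choices h.laminar x b
  rw [choices_eq_of_eq_univ (h.fresh a le_rfl)] at e4
  rw [choices_eq_of_eq_univ (h.fresh b (Nat.le_succ _))] at e5
  have hav : (a : ℕ) = σ.top := rfl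
  have hbv : (b : ℕ) = σ.top + 1 := rfl
  rcases le_or_gt (numGe σ.cand x σ.top) (4 * numEq σ.cand x σ.top) with hc | hc
  · have := numEq_le_sum_card_newHits σ x (j := a) le_rfl ?_
    · rw [hav] at this
      omega
    · have h1 : n - a ≤ 4 * choices (answer σ.cand x a) a := by
        refine Nat.le_of_mul_le_mul_left ?_ h0
        rw [hav] at e4 ⊢
        nlinarith [Nat.mul_le_mul_right (n - σ.top) hc]
      omega
  · have h2 : numGe σ.cand x (σ.top + 1) ≤ 2 * numEq σ.cand x (σ.top + 1) := by omega
    have h3 : 0 < numGe σ.cand x (σ.top + 1) := by omega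
    have := numEq_le_sum_card_newHits σ x (j := b) (Nat.le_succ _) ?_
    · rw [hbv] at this
      omega
    · have h1 : n - b ≤ 2 * choices (answer σ.cand x b) b := by
        refine Nat.le_of_mul_le_mul_left ?_ h3
        rw [hbv] at e5 ⊢
        nlinarith [Nat.mul_le_mul_right (n - (σ.top + 1)) h2]
      omega

/-- On average, the number of hits grows at least proportionally to `top`. -/
lemma Valid.sum_top_sub_hits_step_le {σ : State n} (h : σ.Valid) (hn : 4 ≤ n)
    (ht : 2 * σ.top ≤ n) (x : Fin n → Bool) :
    ∑ π ∈ perms σ.cand, ((((σ.step x (altScore π x)).top : ℝ) -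
      12 * (σ.step x (altScore π x)).hits.card) - (σ.top - 12 * σ.hits.card)) ≤ 0 := by
  have h1 := h.sum_top_step_le (by omega) x
  have h2 := h.numGe_top_le hn ht x
  have h3 : ∀ π, (σ.step x (altScore π x)).hits.card =
      σ.hits.card + (σ.newHits x (altScore π x)).card := by
    intro π
    refine Finset.card_union_of_disjoint (Finset.disjoint_left.2 fun j hj hj' => ?_)
    simp only [newHits, Finset.mem_filter, Finset.mem_univ, true_and] at hj'
    have := h.hits_lt j hj
    omega
  have h4 : ∑ π ∈ perms σ.cand, (σ.step x (altScore π x)).top ≤ (perms σ.cand).card * σ.top +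
      12 * ∑ π ∈ perms σ.cand, (σ.newHits x (altScore π x)).card := by omega
  have h5 : ∑ π ∈ perms σ.cand, ((σ.step x (altScore π x)).top : ℝ) ≤
      (perms σ.cand).card * σ.top +
        12 * ∑ π ∈ perms σ.cand, ((σ.newHits x (altScore π x)).card : ℝ) := by
    exact_mod_cast h4
  simp only [h3, Nat.cast_add, Finset.sum_sub_distrib, mul_add, Finset.sum_add_distrib,
    Finset.sum_const, nsmul_eq_mul, ← Finset.mul_sum]
  linarith

end State

/-! ### The states along a strategy -/

/-- The state reached by `T` on the alternating secret of `π` after `t` queries, frozen once `top`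
exceeds `n / 2`. -/
def traj (T : DetStrategy n) (π : Equiv.Perm (Fin n)) : ℕ → State n
  | 0 => ⟨fun _ => Finset.univ, 0, ∅⟩
  | t + 1 =>
    if 2 * (traj T π t).top ≤ n then
      (traj T π t).step (T.query (altSecret π) t) (altScore π (T.query (altSecret π) t))
    else traj T π t

lemma traj_succ_of_le {T : DetStrategy n} {π : Equiv.Perm (Fin n)} {t : ℕ}
    (h : 2 * (traj T π t).top ≤ n) : traj T π (t + 1) =
      (traj T π t).step (T.query (altSecret π) t) (altScore π (T.query (altSecret π) t)) :=
  if_pos h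

lemma traj_succ_of_not_le {T : DetStrategy n} {π : Equiv.Perm (Fin n)} {t : ℕ}
    (h : ¬ 2 * (traj T π t).top ≤ n) : traj T π (t + 1) = traj T π t :=
  if_neg h

lemma valid_traj (T : DetStrategy n) (π : Equiv.Perm (Fin n)) (t : ℕ) : (traj T π t).Valid := by
  induction t with
  | zero =>
    exact ⟨fun _ _ _ => Or.inl subset_rfl, fun _ _ => rfl, by simp [traj], by simp [traj]⟩
  | succ t ih =>
    by_cases h : 2 * (traj T π t).top ≤ n
    · rw [traj_succ_of_le h]
      exact ih.step _ _
    · rwa [traj_succ_of_not_le h]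

lemma mem_perms_traj (T : DetStrategy n) (π : Equiv.Perm (Fin n)) (t : ℕ) :
    π ∈ perms (traj T π t).cand := by
  induction t with
  | zero => simp [mem_perms, traj]
  | succ t ih =>
    by_cases h : 2 * (traj T π t).top ≤ n
    · rw [traj_succ_of_le h]
      exact (mem_perms_answer (altScore_le _ _)).2 ⟨ih, rfl⟩
    · rwa [traj_succ_of_not_le h]

lemma le_of_traj_succ_le {T : DetStrategy n} {π : Equiv.Perm (Fin n)} {t : ℕ}
    (h : 2 * (traj T π (t + 1)).top ≤ n) : 2 * (traj T π t).top ≤ n := by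
  by_contra h'
  rw [traj_succ_of_not_le h'] at h
  exact h' h

lemma altScore_lt_top_traj {T : DetStrategy n} {π : Equiv.Perm (Fin n)} {t : ℕ}
    (h : 2 * (traj T π t).top ≤ n) {i : ℕ} (hi : i < t) :
    altScore π (T.query (altSecret π) i) < (traj T π t).top := by
  induction t with
  | zero => omega
  | succ t ih =>
    have h' := le_of_traj_succ_le h
    rw [traj_succ_of_le h']
    refine lt_max_iff.2 ?_
    rcases Nat.lt_succ_iff_lt_or_eq.1 hi with hi | rfl
    · exact Or.inl (ih h' hi)
    · exact Or.inr (Nat.lt_succ_self _)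

lemma node_succ_eq_iff {T : DetStrategy n} {s s' : Secret n} {t : ℕ} :
    T.node s' (t + 1) = T.node s (t + 1) ↔
      T.node s' t = T.node s t ∧ score s' (T.query s t) = score s (T.query s t) := by
  simp only [DetStrategy.node, DetStrategy.query]
  constructor
  · intro h
    obtain ⟨h1, h2⟩ := List.append_inj' h rfl
    rw [h1] at h2
    exact ⟨h1, by simpa using h2⟩
  · rintro ⟨h1, h2⟩
    rw [h1, h2]

lemma traj_congr {T : DetStrategy n} {π π' : Equiv.Perm (Fin n)} {t : ℕ}
    (h : T.node (altSecret π') t = T.node (altSecret π) t) : traj T π' t = traj T π t := by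
  induction t with
  | zero => rfl
  | succ t ih =>
    obtain ⟨h1, h2⟩ := node_succ_eq_iff.1 h
    have hq : T.query (altSecret π') t = T.query (altSecret π) t := by
      simp only [DetStrategy.query, h1]
    have hs : altScore π' (T.query (altSecret π) t) = altScore π (T.query (altSecret π) t) :=
      congrArg Fin.val h2
    simp only [traj, ih h1, hq, hs]

/-- While the state is not frozen, its consistent permutations are those reaching its node. -/
lemma mem_perms_traj_iff {T : DetStrategy n} {π π' : Equiv.Perm (Fin n)} {t : ℕ}
    (h : 2 * (traj T π t).top ≤ n) :
    π' ∈ perms (traj T π t).cand ↔ T.node (altSecret π') t = T.node (altSecret π) t := by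
  induction t with
  | zero => simp [mem_perms, traj, DetStrategy.node]
  | succ t ih =>
    have h' := le_of_traj_succ_le h
    rw [traj_succ_of_le h', node_succ_eq_iff, ← ih h']
    refine (mem_perms_answer (altScore_le _ _)).trans (and_congr_right fun _ => ?_)
    exact Fin.val_inj

/-- The permutations on which the state is not frozen after `t` queries. -/
def active (T : DetStrategy n) (t : ℕ) : Finset (Equiv.Perm (Fin n)) :=
  Finset.univ.filter fun π => 2 * (traj T π t).top ≤ n

lemma mem_active {T : DetStrategy n} {t : ℕ} {π : Equiv.Perm (Fin n)} :
    π ∈ active T t ↔ 2 * (traj T π t).top ≤ n := by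
  simp [active]

/-- A bound on the average drift in every state bounds the average total change. -/
lemma sum_traj_succ_sub_le (T : DetStrategy n) (G : State n → ℝ) (C : ℝ)
    (hG : ∀ σ : State n, σ.Valid → 2 * σ.top ≤ n → ∀ x, ∑ π ∈ perms σ.cand,
      (G (σ.step x (altScore π x)) - G σ) ≤ C * (perms σ.cand).card) (t : ℕ) :
    ∑ π, (G (traj T π (t + 1)) - G (traj T π t)) ≤ C * (active T t).card := by
  have h1 : ∑ π, (G (traj T π (t + 1)) - G (traj T π t)) =
      ∑ π ∈ active T t, (G (traj T π (t + 1)) - G (traj T π t)) := by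
    refine (Finset.sum_subset (Finset.subset_univ _) fun π _ hπ => ?_).symm
    rw [mem_active] at hπ
    rw [traj_succ_of_not_le hπ, sub_self]
  have hmaps : ∀ π ∈ active T t,
      T.node (altSecret π) t ∈ (active T t).image fun π => T.node (altSecret π) t :=
    fun π hπ => Finset.mem_image_of_mem (fun π => T.node (altSecret π) t) hπ
  rw [h1, ← Finset.sum_fiberwise_of_maps_to hmaps, Finset.card_eq_sum_card_fiberwise hmaps,
    Nat.cast_sum, Finset.mul_sum]
  refine Finset.sum_le_sum fun l hl => ?_
  obtain ⟨π₀, h0, rfl⟩ := Finset.mem_image.1 hl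
  have h0' := mem_active.1 h0
  have h2 : (active T t).filter (fun π => T.node (altSecret π) t = T.node (altSecret π₀) t) =
      perms (traj T π₀ t).cand := by
    ext π
    rw [mem_perms_traj_iff h0', Finset.mem_filter, mem_active]
    exact and_iff_right_of_imp fun h => by rwa [traj_congr h]
  rw [h2]
  refine le_of_eq_of_le (Finset.sum_congr rfl fun π hπ => ?_)
    (hG _ (valid_traj T π₀ t) h0' (T.query (altSecret π₀) t))
  have h3 := (mem_perms_traj_iff h0').1 hπ
  have h4 := traj_congr h3
  have hq : T.query (altSecret π) t = T.query (altSecret π₀) t := by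
    simp only [DetStrategy.query, h3]
  rw [traj_succ_of_le (by rwa [h4]), h4, hq]

lemma sum_traj_sub_le (T : DetStrategy n) (G : State n → ℝ) (C : ℝ)
    (hG : ∀ σ : State n, σ.Valid → 2 * σ.top ≤ n → ∀ x, ∑ π ∈ perms σ.cand,
      (G (σ.step x (altScore π x)) - G σ) ≤ C * (perms σ.cand).card) (M : ℕ) :
    ∑ π, (G (traj T π M) - G (traj T π 0)) ≤ C * ∑ t ∈ Finset.range M, ((active T t).card : ℝ) := by
  have h : ∀ π, G (traj T π M) - G (traj T π 0) =
      ∑ t ∈ Finset.range M, (G (traj T π (t + 1)) - G (traj T π t)) :=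
    fun π => (Finset.sum_range_sub (fun t => G (traj T π t)) M).symm
  rw [Finset.sum_congr rfl fun π _ => h π, Finset.sum_comm, Finset.mul_sum]
  exact Finset.sum_le_sum fun t _ => sum_traj_succ_sub_le T G C hG t

/-! ### The cost of a strategy on an average alternating secret -/

lemma not_identified {T : DetStrategy n} {π : Equiv.Perm (Fin n)} {t : ℕ} (hn : 4 ≤ n)
    (h : 2 * (traj T π t).top ≤ n) : ¬ T.Identified (altSecret π) t := by
  intro hid
  set last : Fin n := ⟨n - 1, by omega⟩ with hlast
  set s := altSecret π with hs
  have := hid (Function.update s.1 (π last) (!s.1 (π last)), π) fun i hi => ?_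
  · have h1 := congrFun (congrArg Prod.fst this) (π last)
    simp at h1
  · set x := T.query s i
    have hlt : (score s x : ℕ) < n - 1 := by
      have : (score s x : ℕ) < (traj T π t).top := altScore_lt_top_traj h hi
      omega
    have hne : ∀ j : Fin n, (j : ℕ) < n - 1 →
        Function.update s.1 (π last) (!s.1 (π last)) (π j) = s.1 (π j) := fun j hj => by
      refine Function.update_of_ne (fun hj' => ?_) _ _
      rw [π.injective hj'] at hj
      simp [hlast] at hj
    refine Fin.ext (le_antisymm (not_lt.1 fun hgt => ?_) ?_)
    · have h2 := (le_score_iff _ _ _).1 (Nat.succ_le_of_lt hgt)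
      have h3 : (score s x : ℕ) + 1 ≤ score s x := (le_score_iff _ _ _).2
        ⟨h2.1, fun j hj => (hne j (by omega)).symm.trans (h2.2 j hj)⟩
      omega
    · have h2 := (le_score_iff s x _).1 le_rfl
      exact (le_score_iff _ _ _).2
        ⟨h2.1, fun j hj => (hne j (by omega)).trans (h2.2 j hj)⟩

/-- A state with many hits has a large potential. -/
lemma State.Valid.le_potential {σ : State n} (h : σ.Valid) (hne : (perms σ.cand).Nonempty)
    (hn : 2 ≤ Real.log n) :
    ((σ.hits.card : ℝ) - 2 * √n) * Real.log (Real.log n / 2) ≤ σ.potential := by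
  have hn0 : (0 : ℝ) < n := by
    rcases Nat.eq_zero_or_pos n with rfl | h0
    · norm_num at hn
    · exact_mod_cast h0
  have hs : 0 < √(n : ℝ) := Real.sqrt_pos.2 hn0
  have hss : √(n : ℝ) * √n = n := Real.mul_self_sqrt hn0.le
  have hl : 0 ≤ Real.log (Real.log n / 2) := Real.log_nonneg (by linarith)
  have hpos : ∀ j, (0 : ℝ) < choices σ.cand j := fun j => by
    exact_mod_cast choices_pos h.laminar hne j
  have hle : ∀ j, (choices σ.cand j : ℝ) ≤ n := fun j => by exact_mod_cast choices_le _ j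
  set A := σ.hits.filter fun j => (choices σ.cand j : ℝ) ≤ √n
  set B := σ.hits.filter fun j => ¬ (choices σ.cand j : ℝ) ≤ √n with hB
  have hAB : A.card + B.card = σ.hits.card := Finset.card_filter_add_card_filter_not _
  have hABr : (A.card : ℝ) + B.card = σ.hits.card := by exact_mod_cast hAB
  have hBcard : (B.card : ℝ) ≤ 2 * √n := by
    have h1 : (B.card : ℝ) * √n ≤ ∑ j ∈ σ.hits, (choices σ.cand j : ℝ) := by
      rw [← nsmul_eq_mul]
      refine (Finset.card_nsmul_le_sum B _ _ fun j hj => ?_).trans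
        (Finset.sum_le_sum_of_subset_of_nonneg (Finset.filter_subset _ _)
          fun j _ _ => (hpos j).le)
      rw [hB, Finset.mem_filter] at hj
      exact (not_le.1 hj.2).le
    have h2 : ∑ j ∈ σ.hits, (choices σ.cand j : ℝ) ≤ 2 * n := by
      exact_mod_cast h.sum_choices_le
    refine le_of_mul_le_mul_right ?_ hs
    rw [mul_assoc, hss]
    exact h1.trans h2
  have hA : ∀ j ∈ A, Real.log (Real.log n / 2) ≤ pot n (choices σ.cand j) := fun j hj => by
    have hj' : (choices σ.cand j : ℝ) ≤ √n := (Finset.mem_filter.1 hj).2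
    refine Real.log_le_log (by linarith) ?_
    have h1 : Real.log √n ≤ Real.log (2 * n / choices σ.cand j) := by
      refine Real.log_le_log hs ?_
      rw [le_div_iff₀ (hpos j)]
      nlinarith
    rw [Real.log_sqrt hn0.le] at h1
    linarith
  calc ((σ.hits.card : ℝ) - 2 * √n) * Real.log (Real.log n / 2)
      ≤ A.card * Real.log (Real.log n / 2) := by
        gcongr
        linarith
    _ ≤ ∑ j ∈ A, pot n (choices σ.cand j) := by
        rw [← nsmul_eq_mul]
        exact Finset.card_nsmul_le_sum A _ _ hA
    _ ≤ σ.potential := Finset.sum_le_sum_of_subset_of_nonneg (Finset.filter_subset _ _)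
        fun j _ _ => pot_nonneg (hpos j).le (hle j)

/-- If all states are frozen after `M` queries, then the average number of queries before freezing
is large. -/
lemma le_sum_card_active {T : DetStrategy n} {M : ℕ} (hM : ∀ π, π ∉ active T M) (hn : 9216 ≤ n)
    (hlog : 4 ≤ Real.log n) :
    (Nat.factorial n : ℝ) * (1 / 672 * (n * Real.log (Real.log n))) ≤
      ∑ t ∈ Finset.range M, ((active T t).card : ℝ) := by
  have hnr : (9216 : ℝ) ≤ n := by exact_mod_cast hn
  have hcard : (Finset.univ : Finset (Equiv.Perm (Fin n))).card = Nat.factorial n := by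
    rw [Finset.card_univ, Fintype.card_perm, Fintype.card_fin]
  have h1 := sum_traj_sub_le T State.potential 7
    (fun σ hσ _ x => hσ.sum_potential_step_sub_le x) M
  have h2 := sum_traj_sub_le T (fun σ => (σ.top : ℝ) - 12 * σ.hits.card) 0
    (fun σ hσ ht x => by
      rw [zero_mul]
      exact hσ.sum_top_sub_hits_step_le (by omega) ht x) M
  simp only [traj, State.potential, Finset.sum_empty, sub_zero, Finset.card_empty, Nat.cast_zero,
    mul_zero, zero_mul, Finset.sum_sub_distrib, ← Finset.mul_sum] at h1 h2
  set f : ℝ := (Nat.factorial n : ℝ) with hf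
  have hf0 : 0 ≤ f := Nat.cast_nonneg _
  have h3 : f * (n / 2) ≤ ∑ π, ((traj T π M).top : ℝ) := by
    rw [hf, ← hcard, ← nsmul_eq_mul]
    refine Finset.card_nsmul_le_sum _ _ _ fun π _ => ?_
    have := hM π
    rw [mem_active, not_le] at this
    have : (n : ℝ) < 2 * (traj T π M).top := by exact_mod_cast this
    linarith
  set L := Real.log (Real.log n / 2) with hL
  have hL0 : 0 ≤ L := Real.log_nonneg (by linarith)
  have h4 : ∑ π, (((traj T π M).hits.card : ℝ) - 2 * √n) * L ≤
      ∑ π, (traj T π M).potential :=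
    Finset.sum_le_sum fun π _ =>
      (valid_traj T π M).le_potential ⟨π, mem_perms_traj T π M⟩ (by linarith)
  rw [← Finset.sum_mul, Finset.sum_sub_distrib, Finset.sum_const, hcard, nsmul_eq_mul, ← hf] at h4
  have hsqrt : √(n : ℝ) ≤ n / 96 := by
    refine Real.sqrt_le_iff.2 ⟨by positivity, ?_⟩
    nlinarith
  have hLL : Real.log (Real.log n) / 2 ≤ L := by
    have h5 : Real.log (Real.log n) / 2 = Real.log √(Real.log n) :=
      (Real.log_sqrt (by linarith)).symm
    rw [h5, hL]
    refine Real.log_le_log (Real.sqrt_pos.2 (by linarith)) ?_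
    refine Real.sqrt_le_iff.2 ⟨by linarith, ?_⟩
    nlinarith
  have h6 : f * (n / 48) ≤ ∑ π, ((traj T π M).hits.card : ℝ) - f * (2 * √n) := by
    nlinarith [mul_le_mul_of_nonneg_left hsqrt hf0]
  have h7 : f * (n / 48) * (Real.log (Real.log n) / 2) ≤ f * (n / 48) * L := by gcongr
  have h8 := (h7.trans (mul_le_mul_of_nonneg_right h6 hL0)).trans (h4.trans h1)
  linarith

lemma Identified.mono {T : DetStrategy n} {s : Secret n} {t t' : ℕ} (h : T.Identified s t)
    (htt : t ≤ t') : T.Identified s t' :=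
  fun s' hs' => h s' fun i hi => hs' i (hi.trans_le htt)

lemma le_sum_cost (T : DetStrategy n) (hn : 9216 ≤ n) (hlog : 4 ≤ Real.log n) :
    (Nat.factorial n : ℝ≥0∞) * ENNReal.ofReal (1 / 672 * (n * Real.log (Real.log n))) ≤
      ∑ π : Equiv.Perm (Fin n), T.cost (altSecret π) := by
  by_cases hall : ∀ π : Equiv.Perm (Fin n), ∃ t, T.Identified (altSecret π) t
  · classical
    set τ : Equiv.Perm (Fin n) → ℕ := fun π => Nat.find (hall π) with hτ
    have hcost : ∀ π, (τ π : ℝ≥0∞) ≤ T.cost (altSecret π) := fun π =>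
      le_iInf₂ fun t ht => by exact_mod_cast Nat.find_min' (hall π) ht
    have hact : ∀ π t, τ π ≤ t → π ∉ active T t := fun π t ht hπ =>
      not_identified (by omega) (mem_active.1 hπ)
        (Identified.mono (Nat.find_spec (hall π)) ht)
    set M := Finset.univ.sup τ
    have h1 := le_sum_card_active (T := T) (M := M)
      (fun π => hact π M (Finset.le_sup (Finset.mem_univ π))) hn hlog
    have h2 : ∑ t ∈ Finset.range M, (active T t).card ≤ ∑ π, τ π := by
      simp only [active, Finset.card_filter]
      rw [Finset.sum_comm]
      refine Finset.sum_le_sum fun π _ => ?_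
      rw [← Finset.card_filter]
      refine (Finset.card_le_card fun t ht => ?_).trans_eq (Finset.card_range (τ π))
      rw [Finset.mem_range]
      by_contra! hc
      exact hact π t hc (mem_active.2 (Finset.mem_filter.1 ht).2)
    have h3 : (Nat.factorial n : ℝ) * (1 / 672 * (n * Real.log (Real.log n))) ≤
        ((∑ π, τ π : ℕ) : ℝ) := h1.trans (by exact_mod_cast h2)
    calc (Nat.factorial n : ℝ≥0∞) * ENNReal.ofReal (1 / 672 * (n * Real.log (Real.log n)))
        = ENNReal.ofReal ((Nat.factorial n : ℝ) * (1 / 672 * (n * Real.log (Real.log n)))) := by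
          rw [ENNReal.ofReal_mul (Nat.cast_nonneg _), ENNReal.ofReal_natCast]
      _ ≤ ((∑ π, τ π : ℕ) : ℝ≥0∞) := by
          rw [← ENNReal.ofReal_natCast]
          exact ENNReal.ofReal_le_ofReal h3
      _ = ∑ π, (τ π : ℝ≥0∞) := by push_cast; rfl
      _ ≤ ∑ π, T.cost (altSecret π) := Finset.sum_le_sum fun π _ => hcost π
  · push Not at hall
    obtain ⟨π, hπ⟩ := hall
    have : T.cost (altSecret π) = ⊤ := by simp [DetStrategy.cost, hπ]
    rw [(ENNReal.sum_eq_top (s := Finset.univ)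
      (f := fun π => T.cost (altSecret π))).2 ⟨π, Finset.mem_univ _, this⟩]
    exact le_top

/-! ### Measurability of the cost -/

lemma measurableSet_node_eq (s : Secret n) (t : ℕ) (l : List (Fin (n + 1))) :
    MeasurableSet {T : DetStrategy n | T.node s t = l} := by
  induction t generalizing l with
  | zero => exact MeasurableSet.const ([] = l)
  | succ t ih =>
    have : {T : DetStrategy n | T.node s (t + 1) = l} =
        ⋃ l', {T : DetStrategy n | T.node s t = l'} ∩
          (fun T : DetStrategy n => T l') ⁻¹' {x | l' ++ [score s x] = l} := by
      ext T
      simp [DetStrategy.node]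
    rw [this]
    exact MeasurableSet.iUnion fun l' => (ih l').inter
      (measurable_pi_apply l' (Set.toFinite _).measurableSet)

lemma measurable_query (s : Secret n) (t : ℕ) :
    Measurable fun T : DetStrategy n => T.query s t := by
  refine measurable_to_countable' fun x => ?_
  have : (fun T : DetStrategy n => T.query s t) ⁻¹' {x} =
      ⋃ l, {T : DetStrategy n | T.node s t = l} ∩ (fun T : DetStrategy n => T l) ⁻¹' {x} := by
    ext T
    simp [DetStrategy.query]
  rw [this]
  exact MeasurableSet.iUnion fun l => (measurableSet_node_eq s t l).inter
    (measurable_pi_apply l (measurableSet_singleton x))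

lemma measurableSet_identified (s : Secret n) (t : ℕ) :
    MeasurableSet {T : DetStrategy n | T.Identified s t} := by
  have h : Measurable fun (T : DetStrategy n) (i : Fin t) => T.query s i :=
    measurable_pi_lambda _ fun i => measurable_query s i
  have : {T : DetStrategy n | T.Identified s t} =
      (fun (T : DetStrategy n) (i : Fin t) => T.query s i) ⁻¹'
        {q | ∀ s' : Secret n, (∀ i, score s' (q i) = score s (q i)) → s' = s} := by
    ext T
    simp [DetStrategy.Identified, Fin.forall_iff]
  rw [this]
  exact h (Set.toFinite _).measurableSet

lemma measurable_cost (s : Secret n) : Measurable fun T : DetStrategy n => T.cost s := by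
  classical
  refine Measurable.iInf fun t => ?_
  have : (fun T : DetStrategy n => ⨅ (_ : T.Identified s t), (t : ℝ≥0∞)) =
      fun T => if T.Identified s t then (t : ℝ≥0∞) else ⊤ := by
    ext T
    split_ifs with h <;> simp [h]
  rw [this]
  exact Measurable.ite (measurableSet_identified s t) measurable_const measurable_const

/-- A lower bound for the average cost of all deterministic strategies holds for the complexity of
randomized strategies. -/
lemma le_randomizedQueryComplexity {c : ℝ≥0∞}
    (h : ∀ T : DetStrategy n, (Nat.factorial n : ℝ≥0∞) * c ≤
      ∑ π : Equiv.Perm (Fin n), T.cost (altSecret π)) : c ≤ randomizedQueryComplexity n := by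
  refine le_iInf fun R => ?_
  have h1 : (Nat.factorial n : ℝ≥0∞) * c ≤ Nat.factorial n * R.complexity :=
    calc (Nat.factorial n : ℝ≥0∞) * c
        = ∫⁻ _, (Nat.factorial n : ℝ≥0∞) * c ∂(R : Measure (DetStrategy n)) := by simp
      _ ≤ ∫⁻ T, ∑ π : Equiv.Perm (Fin n), T.cost (altSecret π) ∂(R : Measure (DetStrategy n)) :=
          lintegral_mono h
      _ = ∑ π : Equiv.Perm (Fin n), ∫⁻ T, T.cost (altSecret π) ∂(R : Measure (DetStrategy n)) :=
          lintegral_finsetSum _ fun π _ => measurable_cost _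
      _ ≤ ∑ _π : Equiv.Perm (Fin n), R.complexity := Finset.sum_le_sum fun π _ =>
          le_iSup (fun s => ∫⁻ T, T.cost s ∂(R : Measure (DetStrategy n))) (altSecret π)
      _ = Nat.factorial n * R.complexity := by
          rw [Finset.sum_const, Finset.card_univ, Fintype.card_perm, Fintype.card_fin,
            nsmul_eq_mul]
  exact (ENNReal.mul_le_mul_iff_right (by exact_mod_cast Nat.factorial_ne_zero n)
    (ENNReal.natCast_ne_top _)).1 h1

end PermMastermind

theorem mainTheorem1 :
    ∃ c : ℝ, 0 < c ∧ ∀ᶠ n : ℕ in atTop,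
      ENNReal.ofReal (c * ((n : ℝ) * Real.log (Real.log (n : ℝ)))) ≤
        PermMastermind.randomizedQueryComplexity n := by
  refine ⟨1 / 672, by norm_num, ?_⟩
  have hlog : ∀ᶠ n : ℕ in atTop, 4 ≤ Real.log n :=
    (Real.tendsto_log_atTop.comp tendsto_natCast_atTop_atTop).eventually_ge_atTop 4
  filter_upwards [eventually_ge_atTop 9216, hlog] with n hn h4
  exact PermMastermind.le_randomizedQueryComplexity fun T => PermMastermind.le_sum_cost T hn h4
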